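/- Let $\mathbb{D}$ be the open unit disc in $\mathbb{C}$ and let $H^2$ be the Hardy space of all holomorphic functions $f$ on $\mathbb{D}$ with $$\|f\|_2=\sup_{0\le r<1}\Big(\frac1{2\pi}\int_0^{2\pi}|f(re^{it})|^2\,dt\Big)^{1/2}<\infty .$$ An automorphism of $\mathbb{D}$ is a holomorphic bijection $\varphi:\mathbb{D}\to\mathbb{D}$ with holomorphic inverse; it is called parabolic if there is exactly one point $w$ with $|w|=1$ and $\lim_{r\to1^-}\varphi(rw)=w$. Write $\varphi_m$ for the $m$-fold composition of $\varphi$ with itself ($\varphi_0=\mathrm{id}$). Let $\varphi$ be a parabolic automorphism of $\mathbb{D}$. Then: (i) for every $z\in\mathbb{D}$, $\sum_{m\ge0}\big(1-|\varphi_m(z)|\big)<\infty$; (ii) the composition operator $C_\varphi f=f\circ\varphi$ is a bounded linear operator on $H^2$, and for every $z\in\mathbb{D}$ the Blaschke product $$B_z(w)=\prod_{m\ge0}b_{\varphi_m(z)}(w),\qquad b_a(w)=\frac{|a|}{a}\,\frac{a-w}{1-\overline a\,w}\ (a\ne0),\qquad b_0(w)=w,$$ converges unconditionally at every $w\in\mathbb{D}$,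 and $B_zH^2=\{B_zh:h\in H^2\}$ is a closed subspace of $H^2$ that is invariant under $C_\varphi$, that is, $C_\varphi(B_zH^2)\subseteq B_zH^2$. -/

import Mathlib

open Complex Metric Filter Topology Real
open scoped Complex.UnitDisc

noncomputable section

namespace DiscHardy

/-- The extension by zero to `ℂ` of a function on the open unit disc. Only its values inside the
disc are ever used. -/
def ext0 (f : 𝔻 → ℂ) (w : ℂ) : ℂ := if h : ‖w‖ < 1 then f (UnitDisc.mk w h) else 0

/-- `f` is a holomorphic function on the open unit disc. -/
def IsHolo (f : 𝔻 → ℂ) : Prop := DifferentiableOn ℂ (ext0 f) (ball 0 1)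

/-! ### The Hardy space -/

/-- `(1 / 2π) ∫₀^{2π} |f (r e^{it})|² dt`. -/
def meanSq (f : 𝔻 → ℂ) (r : ℝ) : ℝ := circleAverage (fun w : ℂ => ‖ext0 f w‖ ^ 2) 0 r

/-- Membership in `H²`: holomorphic, with bounded square means over the circles of radius
`0 ≤ r < 1`. -/
def MemH2 (f : 𝔻 → ℂ) : Prop :=
  IsHolo f ∧ BddAbove (Set.range fun r : Set.Ico (0 : ℝ) 1 => meanSq f r)

/-- The Hardy norm `sup_{0 ≤ r < 1} ((1 / 2π) ∫₀^{2π} |f (r e^{it})|² dt) ^ (1/2)`. -/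
def hardyNorm (f : 𝔻 → ℂ) : ℝ := ⨆ r : Set.Ico (0 : ℝ) 1, √(meanSq f r)

theorem ext0_coe (f : 𝔻 → ℂ) (z : 𝔻) : ext0 f (z : ℂ) = f z := by
  simp [ext0, z.norm_lt_one]

theorem ext0_add (f g : 𝔻 → ℂ) (w : ℂ) : ext0 (f + g) w = ext0 f w + ext0 g w := by
  unfold ext0; split_ifs <;> simp

theorem ext0_smul (c : ℂ) (f : 𝔻 → ℂ) (w : ℂ) : ext0 (c • f) w = c * ext0 f w := by
  unfold ext0; split_ifs <;> simp

theorem ext0_zero (w : ℂ) : ext0 0 w = 0 := by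
  unfold ext0; split_ifs <;> simp

theorem IsHolo.add {f g : 𝔻 → ℂ} (hf : IsHolo f) (hg : IsHolo g) : IsHolo (f + g) := by
  have h : ext0 (f + g) = ext0 f + ext0 g := funext (ext0_add f g)
  unfold IsHolo; rw [h]; exact DifferentiableOn.add hf hg

theorem IsHolo.smul (c : ℂ) {f : 𝔻 → ℂ} (hf : IsHolo f) : IsHolo (c • f) := by
  have h : ext0 (c • f) = c • ext0 f := funext (ext0_smul c f)
  unfold IsHolo; rw [h]; exact DifferentiableOn.const_smul hf c

theorem IsHolo.continuous_circle {f : 𝔻 → ℂ} (hf : IsHolo f) {r : ℝ}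
    (hr : r ∈ Set.Ico (0 : ℝ) 1) :
    Continuous fun t : ℝ => ‖ext0 f (circleMap 0 r t)‖ ^ 2 := by
  have h : Continuous fun t : ℝ => ext0 f (circleMap 0 r t) := by
    refine hf.continuousOn.comp_continuous (continuous_circleMap 0 r) fun t => ?_
    simp [abs_of_nonneg hr.1, hr.2]
  exact h.norm.pow 2

theorem IsHolo.circleIntegrable {f : 𝔻 → ℂ} (hf : IsHolo f) {r : ℝ}
    (hr : r ∈ Set.Ico (0 : ℝ) 1) :
    CircleIntegrable (fun w : ℂ => ‖ext0 f w‖ ^ 2) 0 r :=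
  (hf.continuous_circle hr).intervalIntegrable _ _

theorem meanSq_nonneg (f : 𝔻 → ℂ) (r : ℝ) : 0 ≤ meanSq f r :=
  circleAverage_nonneg_of_nonneg fun _ _ => by positivity

theorem meanSq_smul (c : ℂ) (f : 𝔻 → ℂ) (r : ℝ) : meanSq (c • f) r = ‖c‖ ^ 2 * meanSq f r := by
  unfold meanSq
  rw [← smul_eq_mul, ← circleAverage_fun_smul]
  simp only [ext0_smul, norm_mul, mul_pow, smul_eq_mul]

theorem meanSq_add_le {f g : 𝔻 → ℂ} (hf : IsHolo f) (hg : IsHolo g) {r : ℝ}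
    (hr : r ∈ Set.Ico (0 : ℝ) 1) {a b : ℝ} (ha : 0 < a) (hb : 0 < b)
    (hfa : meanSq f r ≤ a ^ 2) (hgb : meanSq g r ≤ b ^ 2) :
    meanSq (f + g) r ≤ (a + b) ^ 2 := by
  have hif := hf.circleIntegrable hr
  have hig := hg.circleIntegrable hr
  have hif' : CircleIntegrable (fun w : ℂ => (1 + b / a) • ‖ext0 f w‖ ^ 2) 0 r :=
    ((hf.continuous_circle hr).const_smul (1 + b / a)).intervalIntegrable _ _
  have hig' : CircleIntegrable (fun w : ℂ => (1 + a / b) • ‖ext0 g w‖ ^ 2) 0 r :=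
    ((hg.continuous_circle hr).const_smul (1 + a / b)).intervalIntegrable _ _
  have h1 : meanSq (f + g) r ≤ (1 + b / a) * meanSq f r + (1 + a / b) * meanSq g r := by
    unfold meanSq
    rw [← smul_eq_mul, ← smul_eq_mul, ← circleAverage_fun_smul, ← circleAverage_fun_smul,
      ← circleAverage_fun_add hif' hig']
    refine circleAverage_mono ((hf.add hg).circleIntegrable hr) (hif'.add hig') fun w _ => ?_
    simp only [ext0_add, smul_eq_mul]
    set u := ‖ext0 f w‖
    set v := ‖ext0 g w‖
    have h2 : ‖ext0 f w + ext0 g w‖ ^ 2 ≤ (u + v) ^ 2 := by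
      gcongr; exact norm_add_le _ _
    have h3 : (1 + b / a) * u ^ 2 + (1 + a / b) * v ^ 2 - (u + v) ^ 2
        = (b * u - a * v) ^ 2 / (a * b) := by
      field_simp; ring
    have h4 : 0 ≤ (b * u - a * v) ^ 2 / (a * b) := by positivity
    linarith
  calc meanSq (f + g) r ≤ (1 + b / a) * a ^ 2 + (1 + a / b) * b ^ 2 := by
        refine h1.trans ?_
        gcongr
    _ = (a + b) ^ 2 := by field_simp; ring

theorem MemH2.meanSq_le {f : 𝔻 → ℂ} (hf : MemH2 f) {r : ℝ} (hr : r ∈ Set.Ico (0 : ℝ) 1) :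
    √(meanSq f r) ≤ hardyNorm f := by
  obtain ⟨C, hC⟩ := hf.2
  refine le_ciSup (f := fun r : Set.Ico (0 : ℝ) 1 => √(meanSq f r)) ⟨√C, ?_⟩ ⟨r, hr⟩
  rintro _ ⟨s, rfl⟩
  exact Real.sqrt_le_sqrt (hC ⟨s, rfl⟩)

theorem hardyNorm_nonneg (f : 𝔻 → ℂ) : 0 ≤ hardyNorm f :=
  Real.iSup_nonneg fun _ => Real.sqrt_nonneg _

theorem MemH2.meanSq_add_le {f g : 𝔻 → ℂ} (hf : MemH2 f) (hg : MemH2 g) {r : ℝ}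
    (hr : r ∈ Set.Ico (0 : ℝ) 1) {e : ℝ} (he : 0 < e) :
    meanSq (f + g) r ≤ ((hardyNorm f + e) + (hardyNorm g + e)) ^ 2 := by
  have key : ∀ {k : 𝔻 → ℂ}, MemH2 k → meanSq k r ≤ (hardyNorm k + e) ^ 2 := fun {k} hk => by
    have h := hk.meanSq_le hr
    have h0 := hardyNorm_nonneg k
    exact (Real.sqrt_le_left (by positivity)).1 (h.trans (by linarith))
  exact DiscHardy.meanSq_add_le hf.1 hg.1 hr
    (add_pos_of_nonneg_of_pos (hardyNorm_nonneg f) he)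
    (add_pos_of_nonneg_of_pos (hardyNorm_nonneg g) he) (key hf) (key hg)

theorem MemH2.add {f g : 𝔻 → ℂ} (hf : MemH2 f) (hg : MemH2 g) : MemH2 (f + g) := by
  refine ⟨hf.1.add hg.1, ((hardyNorm f + 1) + (hardyNorm g + 1)) ^ 2, ?_⟩
  rintro _ ⟨r, rfl⟩
  exact hf.meanSq_add_le hg r.2 one_pos

theorem MemH2.smul (c : ℂ) {f : 𝔻 → ℂ} (hf : MemH2 f) : MemH2 (c • f) := by
  obtain ⟨C, hC⟩ := hf.2
  refine ⟨hf.1.smul c, ‖c‖ ^ 2 * C, ?_⟩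
  rintro _ ⟨r, rfl⟩
  simp only [meanSq_smul]
  gcongr
  exact hC ⟨r, rfl⟩

theorem MemH2.zero : MemH2 0 := by
  have h : ext0 0 = fun _ => 0 := funext ext0_zero
  refine ⟨?_, 0, ?_⟩
  · unfold IsHolo; rw [h]; exact differentiableOn_const 0
  · rintro _ ⟨r, rfl⟩
    simp [meanSq, h, circleAverage_def]

theorem hardyNorm_add_le {f g : 𝔻 → ℂ} (hf : MemH2 f) (hg : MemH2 g) :
    hardyNorm (f + g) ≤ hardyNorm f + hardyNorm g := by
  refine le_of_forall_pos_le_add fun e he => ?_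
  have : Nonempty (Set.Ico (0 : ℝ) 1) := ⟨⟨0, by simp⟩⟩
  refine ciSup_le fun r => ?_
  have hf0 := hardyNorm_nonneg f
  have hg0 := hardyNorm_nonneg g
  refine (Real.sqrt_le_left (by positivity)).2 ?_
  refine (hf.meanSq_add_le hg r.2 (half_pos he)).trans (le_of_eq ?_)
  ring

theorem hardyNorm_smul (c : ℂ) (f : 𝔻 → ℂ) : hardyNorm (c • f) = ‖c‖ * hardyNorm f := by
  unfold hardyNorm
  rw [Real.mul_iSup_of_nonneg (norm_nonneg c)]
  refine iSup_congr fun r => ?_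
  rw [meanSq_smul, Real.sqrt_mul (by positivity), Real.sqrt_sq (norm_nonneg c)]

theorem MemH2.eq_zero {f : 𝔻 → ℂ} (hf : MemH2 f) (h : hardyNorm f = 0) : f = 0 := by
  funext z
  by_contra hz
  have hr : ‖(z : ℂ)‖ ∈ Set.Ico (0 : ℝ) 1 := ⟨norm_nonneg _, z.norm_lt_one⟩
  have h1 := hf.meanSq_le hr
  rw [h, Real.sqrt_le_left le_rfl] at h1
  have hmem : (z : ℂ) ∈ circleMap 0 ‖(z : ℂ)‖ '' Set.Ioc 0 (2 * π) := by
    rw [image_circleMap_Ioc]; simp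
  obtain ⟨t, ht, hzt⟩ := hmem
  have h2 : 0 < ∫ t in (0 : ℝ)..2 * π, ‖ext0 f (circleMap 0 ‖(z : ℂ)‖ t)‖ ^ 2 := by
    refine intervalIntegral.integral_pos (by positivity)
      (hf.1.continuous_circle hr).continuousOn (fun _ _ => by positivity)
      ⟨t, Set.Ioc_subset_Icc_self ht, ?_⟩
    rw [hzt, ext0_coe]
    have : 0 < ‖f z‖ := norm_pos_iff.2 hz
    positivity
  have h3 : 0 < meanSq f ‖(z : ℂ)‖ := by
    unfold meanSq
    rw [circleAverage_def, smul_eq_mul]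
    positivity
  norm_num at h1
  linarith

/-- `H²` as a linear space of functions on the disc. -/
def hardySubmodule : Submodule ℂ (𝔻 → ℂ) where
  carrier := {f | MemH2 f}
  add_mem' := MemH2.add
  zero_mem' := MemH2.zero
  smul_mem' := fun c _ hf => hf.smul c

/-- The Hardy space `H²`, a type of its own so that it carries the topology of the Hardy norm and
not that of pointwise convergence. -/
def H2 : Type := hardySubmodule

instance : AddCommGroup H2 := inferInstanceAs (AddCommGroup hardySubmodule)

instance : Module ℂ H2 := inferInstanceAs (Module ℂ hardySubmodule)

/-- An element of `H²` as a function on the disc. -/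
def H2.toFun : H2 →ₗ[ℂ] (𝔻 → ℂ) := hardySubmodule.subtype

instance : CoeFun H2 fun _ => 𝔻 → ℂ := ⟨fun f => H2.toFun f⟩

instance : Norm H2 := ⟨fun f => hardyNorm f⟩

theorem H2.core : NormedSpace.Core ℂ H2 where
  norm_nonneg f := hardyNorm_nonneg f
  norm_smul c f := hardyNorm_smul c f
  norm_triangle f g := hardyNorm_add_le f.2 g.2
  norm_eq_zero_iff f := by
    constructor
    · intro h
      exact Subtype.ext (MemH2.eq_zero f.2 h)
    · rintro rfl
      have h := hardyNorm_smul 0 (0 : 𝔻 → ℂ)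
      rw [zero_smul, norm_zero, zero_mul] at h
      exact h

instance : NormedAddCommGroup H2 := NormedAddCommGroup.ofCore H2.core

instance : NormedSpace ℂ H2 := NormedSpace.ofCore H2.core

/-! ### Automorphisms, invariant subspaces, Blaschke products -/

/-- `φ` is an automorphism of the disc: a holomorphic self map with a holomorphic inverse. -/
def IsAutomorphism (φ : 𝔻 → 𝔻) : Prop :=
  IsHolo (fun z => (φ z : ℂ)) ∧
    ∃ ψ : 𝔻 → 𝔻, IsHolo (fun z => (ψ z : ℂ)) ∧ Function.LeftInverse ψ φ ∧
      Function.RightInverse ψ φ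

/-- The point `w` of the unit circle is a boundary fixed point of `φ`: the radial limit
`lim_{r → 1⁻} φ (r w)` exists and equals `w`. -/
def IsBoundaryFixedPoint (φ : 𝔻 → 𝔻) (w : ℂ) : Prop :=
  ‖w‖ = 1 ∧ Tendsto (fun r : ℝ => ext0 (fun z => (φ z : ℂ)) (r * w)) (𝓝[<] 1) (𝓝 w)

/-- A parabolic automorphism: it has exactly one fixed point on the unit circle. -/
def IsParabolicAutomorphism (φ : 𝔻 → 𝔻) : Prop :=
  IsAutomorphism φ ∧ ∃! w : ℂ, IsBoundaryFixedPoint φ w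

/-- `Lat T`: the closed invariant subspaces of the bounded operator `T`. -/
def Lat {E : Type*} [NormedAddCommGroup E] [NormedSpace ℂ E] (T : E →L[ℂ] E) :
    Set (Submodule ℂ E) :=
  {S | IsClosed (S : Set E) ∧ ∀ f ∈ S, T f ∈ S}

/-- The Blaschke factor with zero `a`; it is `w ↦ w` when `a = 0`. -/
def blaschkeFactor (a w : 𝔻) : ℂ :=
  if (a : ℂ) = 0 then (w : ℂ)
  else ((‖(a : ℂ)‖ : ℂ) / a) * ((a - w) / (1 - (starRingEnd ℂ) (a : ℂ) * w))

/-- The Blaschke product with zeros `a 0, a 1, …`, repeated according to multiplicity. -/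
def blaschkeProduct (a : ℕ → 𝔻) (w : 𝔻) : ℂ := ∏' m, blaschkeFactor (a m) w

/-- The space `θ H² = {θ h : h ∈ H²}` of functions on the disc. -/
def mulH2 (θ : 𝔻 → ℂ) : Submodule ℂ (𝔻 → ℂ) := hardySubmodule.map (LinearMap.mulLeft ℂ θ)

end DiscHardy

end

/-! Let w be the boundary fixed point of φ. The coordinate W = w/(w - z) turns φ into a translation
W ↦ W + β with β ≠ 0 purely imaginary (`IsParabolicAutomorphism.exists_translation`). Since |W|²(1 -
|z|²) = 2 Re W - 1 and Re W is constant along an orbit, 1 - |φ_m(z)| is at most a constant times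
1/|W + mβ|², which is summable.

Boundedness of C_φ is Littlewood subordination: |f|² lies below its Poisson integral, the real part
of a holomorphic function, so the mean after composition is at most the value of that integral at
φ(0), which the bound on the Poisson kernel controls.

Multiplication by a Blaschke product B is an isometry (`hardyNorm_blaschkeProduct_mul`) and H² is
complete, so B H² is closed. No boundary values are used: finitely many factors are removed by
letting the radius tend to 1, and the remaining tail is close to 1 on any fixed circle.

For invariance, b_{φ(a)} ∘ φ is a unimodular multiple of b_a. Hence the factors of B_z ∘ φ with
index m ≥ 1 rebuild B_z, and the factor m = 0 is left over: B_z ∘ φ = c · B_z · (b_z ∘ φ). Thus (B_z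
h) ∘ φ = B_z · c (b_z h) ∘ φ. -/

noncomputable section

namespace DiscHardy

/-! ### Poisson majorants and subordination -/

/-- The squared modulus of a holomorphic function is dominated by its Poisson integral. -/
theorem norm_sq_le_circleAverage_herglotz {g : ℂ → ℂ} {ρ : ℝ}
    (hg : DiffContOnCl ℂ g (ball 0 ρ)) {w : ℂ} (hw : w ∈ ball (0 : ℂ) ρ) :
    ‖g w‖ ^ 2 ≤
      circleAverage ((re ∘ herglotzRieszKernel 0 w) • fun ζ => ‖g ζ‖ ^ 2) 0 ρ := by
  have hρ : 0 < ρ := pos_of_mem_ball hw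
  set c := (starRingEnd ℂ) (g w)
  have hgc : ContinuousOn g (sphere 0 |ρ|) := by
    rw [abs_of_pos hρ]
    refine hg.continuousOn.mono ?_
    rw [closure_ball _ hρ.ne']
    exact sphere_subset_closedBall
  have hk : ContinuousOn (re ∘ herglotzRieszKernel 0 w) (sphere 0 |ρ|) :=
    continuous_re.comp_continuousOn (continuousOn_herglotzRieszKernel_sphere hw)
  -- Expanding |g(z) - g(w)|² ≥ 0 shows that the real part of this holomorphic function of z is at
  -- most |g(z)|², with equality at z = w. The Poisson formula for it then gives the claim.
  have h1 : DiffContOnCl ℂ (fun z => 2 * c * g z - c * g w) (ball 0 ρ) :=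
    (hg.const_smul (2 * c)).sub_const (c * g w)
  have h2 := h1.circleAverage_re_herglotzRieszKernel_smul hw
  have hi : CircleIntegrable
      ((re ∘ herglotzRieszKernel 0 w) • fun z => 2 * c * g z - c * g w) 0 ρ :=
    ContinuousOn.circleIntegrable' (hk.smul ((continuousOn_const.mul hgc).sub continuousOn_const))
  have h3 := Complex.reCLM.circleAverage_comp_comm hi
  have h4 : reCLM (2 * c * g w - c * g w) = ‖g w‖ ^ 2 := by
    have : 2 * c * g w - c * g w = ((‖g w‖ ^ 2 : ℝ) : ℂ) := by
      push_cast
      rw [← Complex.conj_mul']; ring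
    rw [this]; exact ofReal_re _
  rw [h2, h4] at h3
  rw [← h3]
  refine circleAverage_mono (ContinuousOn.circleIntegrable' ?_)
    (ContinuousOn.circleIntegrable' (hk.smul (hgc.norm.pow 2))) fun z hz => ?_
  · exact continuous_re.comp_continuousOn
      (hk.smul ((continuousOn_const.mul hgc).sub continuousOn_const))
  · rw [abs_of_pos hρ] at hz
    have hnn : 0 ≤ (herglotzRieszKernel 0 w z).re := by
      refine le_trans ?_ (le_re_herglotzRieszKernel hz hw)
      have : ‖w - 0‖ < ρ := by simpa using hw
      exact div_nonneg (by linarith) (by positivity)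
    have hle : (2 * c * g z - c * g w).re ≤ ‖g z‖ ^ 2 := by
      have h5 : ‖g z - g w‖ ^ 2 = ‖g z‖ ^ 2 - (2 * c * g z - c * g w).re := by
        rw [← normSq_eq_norm_sq, ← normSq_eq_norm_sq, normSq_apply, normSq_apply]
        simp [c]
        ring
      have := sq_nonneg ‖g z - g w‖
      linarith
    simp only [Function.comp_apply, Pi.smul_apply', smul_eq_mul, reCLM_apply, real_smul,
      re_ofReal_mul]
    exact mul_le_mul_of_nonneg_left hle hnn

/-- Littlewood's subordination inequality for square means. -/
theorem circleAverage_norm_sq_comp_le {g ψ : ℂ → ℂ} {r ρ : ℝ} (hr : 0 ≤ r)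
    (hg : DiffContOnCl ℂ g (ball 0 ρ)) (hψ : DiffContOnCl ℂ ψ (ball 0 r))
    (hmap : Set.MapsTo ψ (closedBall 0 r) (ball 0 ρ)) :
    circleAverage (fun z => ‖g (ψ z)‖ ^ 2) 0 r ≤
      (ρ + ‖ψ 0‖) / (ρ - ‖ψ 0‖) * circleAverage (fun z => ‖g z‖ ^ 2) 0 ρ := by
  have h0 : ψ 0 ∈ ball (0 : ℂ) ρ := hmap (by simpa using hr)
  have hρ : 0 < ρ := pos_of_mem_ball h0
  have hgc : ContinuousOn g (sphere 0 |ρ|) := by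
    rw [abs_of_pos hρ]
    refine hg.continuousOn.mono ?_
    rw [closure_ball _ hρ.ne']
    exact sphere_subset_closedBall
  have hgi : CircleIntegrable (fun z => ‖g z‖ ^ 2) 0 ρ :=
    ContinuousOn.circleIntegrable' (hgc.norm.pow 2)
  have hgi' : CircleIntegrable (fun z => ((‖g z‖ ^ 2 : ℝ) : ℂ)) 0 ρ :=
    ContinuousOn.circleIntegrable' (continuous_ofReal.comp_continuousOn (hgc.norm.pow 2))
  -- A holomorphic function whose real part is the Poisson integral of |g|², so the mean value
  -- property applies to H ∘ ψ.
  set H : ℂ → ℂ := fun w =>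
    circleAverage (fun ζ => herglotzRieszKernel 0 w ζ • ((‖g ζ‖ ^ 2 : ℝ) : ℂ)) 0 ρ
  have hH : DifferentiableOn ℂ H (ball 0 ρ) :=
    differentiableOn_circleAverage_herglotzRieszKernel_smul hgi'
  have hHre : ∀ w ∈ ball (0 : ℂ) ρ, (H w).re =
      circleAverage ((re ∘ herglotzRieszKernel 0 w) • fun ζ => ‖g ζ‖ ^ 2) 0 ρ := fun w hw =>
    re_circleAverage_herglotzRieszKernel_smul hgi hw
  have hψc : ContinuousOn ψ (closedBall 0 r) := by
    rcases hr.eq_or_lt with rfl | hr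
    · simp
    · simpa [closure_ball _ hr.ne'] using hψ.continuousOn
  have hHψc : ContinuousOn (fun z => H (ψ z)) (closedBall 0 r) :=
    hH.continuousOn.comp hψc hmap
  have hHψ : DiffContOnCl ℂ (fun z => H (ψ z)) (ball 0 r) := by
    refine ⟨hH.comp hψ.differentiableOn (hmap.mono_left ball_subset_closedBall), ?_⟩
    exact hHψc.mono closure_ball_subset_closedBall
  have hsub : sphere (0 : ℂ) |r| ⊆ closedBall 0 r := by
    rw [abs_of_nonneg hr]; exact sphere_subset_closedBall
  have hHi : CircleIntegrable (fun z => H (ψ z)) 0 r :=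
    ContinuousOn.circleIntegrable' (hHψc.mono hsub)
  have hmean : circleAverage (fun z => (H (ψ z)).re) 0 r = (H (ψ 0)).re := by
    have h1 := Complex.reCLM.circleAverage_comp_comm hHi
    have h2 : circleAverage (fun z => H (ψ z)) 0 r = H (ψ 0) :=
      DiffContOnCl.circleAverage (by rwa [abs_of_nonneg hr])
    rw [h2] at h1
    exact h1
  have hgψ : ContinuousOn (fun z => g (ψ z)) (closedBall 0 r) :=
    hg.continuousOn.comp hψc fun z hz => subset_closure (hmap hz)
  calc circleAverage (fun z => ‖g (ψ z)‖ ^ 2) 0 r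
      ≤ circleAverage (fun z => (H (ψ z)).re) 0 r := by
        refine circleAverage_mono (ContinuousOn.circleIntegrable' ((hgψ.mono hsub).norm.pow 2))
          (ContinuousOn.circleIntegrable'
            (continuous_re.comp_continuousOn (hHψc.mono hsub))) fun z hz => ?_
        rw [hHre _ (hmap (hsub hz))]
        exact norm_sq_le_circleAverage_herglotz hg (hmap (hsub hz))
    _ = circleAverage ((re ∘ herglotzRieszKernel 0 (ψ 0)) • fun ζ => ‖g ζ‖ ^ 2) 0 ρ := by
        rw [hmean, hHre _ h0]
    _ ≤ _ := by
        rw [← smul_eq_mul, ← circleAverage_smul]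
        refine circleAverage_mono (ContinuousOn.circleIntegrable' ?_)
          (ContinuousOn.circleIntegrable' ((hgc.norm.pow 2).const_smul _)) fun z hz => ?_
        · exact (continuous_re.comp_continuousOn
            (continuousOn_herglotzRieszKernel_sphere h0)).smul (hgc.norm.pow 2)
        · rw [abs_of_pos hρ] at hz
          have := re_herglotzRieszKernel_le hz h0
          simp only [sub_zero] at this
          simp only [Function.comp_apply, Pi.smul_apply', smul_eq_mul, Pi.smul_apply,
            herglotzRieszKernel_def, sub_zero]
          gcongr

/-! ### Composition operators and point evaluations -/

theorem IsHolo.diffContOnCl {f : 𝔻 → ℂ} (hf : IsHolo f) {ρ : ℝ} (hρ : ρ < 1) :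
    DiffContOnCl ℂ (ext0 f) (ball 0 ρ) :=
  DifferentiableOn.diffContOnCl_ball hf (closedBall_subset_ball hρ)

theorem ext0_of_lt {f : 𝔻 → ℂ} {w : ℂ} (hw : ‖w‖ < 1) : ext0 f w = f (UnitDisc.mk w hw) :=
  dif_pos hw

theorem IsHolo.congr {f : 𝔻 → ℂ} {F : ℂ → ℂ} (hF : DifferentiableOn ℂ F (ball 0 1))
    (h : ∀ z : 𝔻, f z = F z) : IsHolo f := by
  refine DifferentiableOn.congr hF fun z hz => ?_
  rw [ext0_of_lt (by simpa using hz), h]; simp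

theorem isHolo_const (c : ℂ) : IsHolo fun _ => c :=
  IsHolo.congr (F := fun _ => c) (differentiableOn_const c) fun _ => rfl

theorem mapsTo_ext0_coe (φ : 𝔻 → 𝔻) :
    Set.MapsTo (ext0 fun z => (φ z : ℂ)) (ball 0 1) (ball 0 1) := fun w hw => by
  rw [ext0_of_lt (by simpa using hw)]
  simpa using (φ _).norm_lt_one

theorem ext0_comp (f : 𝔻 → ℂ) (φ : 𝔻 → 𝔻) {w : ℂ} (hw : ‖w‖ < 1) :
    ext0 (f ∘ φ) w = ext0 f (ext0 (fun z => (φ z : ℂ)) w) := by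
  rw [ext0_of_lt hw, ext0_of_lt hw, ext0_coe]; rfl

theorem IsHolo.comp {f : 𝔻 → ℂ} (hf : IsHolo f) {φ : 𝔻 → 𝔻} (hφ : IsHolo fun z => (φ z : ℂ)) :
    IsHolo (f ∘ φ) :=
  (DifferentiableOn.comp hf hφ (mapsTo_ext0_coe φ)).congr fun w hw =>
    ext0_comp f φ (by simpa using hw)

theorem IsHolo.mul {f g : 𝔻 → ℂ} (hf : IsHolo f) (hg : IsHolo g) : IsHolo (f * g) := by
  refine (DifferentiableOn.mul hf hg).congr fun w hw => ?_
  have hw : ‖w‖ < 1 := by simpa using hw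
  simp [ext0_of_lt hw]

theorem MemH2.meanSq_le_sq {f : 𝔻 → ℂ} (hf : MemH2 f) {r : ℝ} (hr : r ∈ Set.Ico (0 : ℝ) 1) :
    meanSq f r ≤ hardyNorm f ^ 2 :=
  (Real.sqrt_le_left (hardyNorm_nonneg f)).1 (hf.meanSq_le hr)

theorem memH2_of_meanSq_le {f : 𝔻 → ℂ} (hf : IsHolo f) {M : ℝ}
    (h : ∀ r ∈ Set.Ico (0 : ℝ) 1, meanSq f r ≤ M ^ 2) : MemH2 f :=
  ⟨hf, M ^ 2, by rintro _ ⟨r, rfl⟩; exact h r r.2⟩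

theorem hardyNorm_le_of_meanSq_le {f : 𝔻 → ℂ} {M : ℝ} (hM : 0 ≤ M)
    (h : ∀ r ∈ Set.Ico (0 : ℝ) 1, meanSq f r ≤ M ^ 2) : hardyNorm f ≤ M :=
  Real.iSup_le (fun r => (Real.sqrt_le_left hM).2 (h r r.2)) hM

/-- Square means increase with the radius. -/
theorem IsHolo.meanSq_mono {f : 𝔻 → ℂ} (hf : IsHolo f) {r ρ : ℝ} (hr : 0 ≤ r) (hrρ : r ≤ ρ)
    (hρ : ρ < 1) : meanSq f r ≤ meanSq f ρ := by
  rcases hrρ.eq_or_lt with rfl | hlt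
  · rfl
  -- Subordination along the inclusion of the smaller disc; the constant is 1 because `id` fixes 0.
  have h := circleAverage_norm_sq_comp_le (ψ := id) hr (hf.diffContOnCl hρ)
    differentiable_id.diffContOnCl (closedBall_subset_ball hlt)
  have h0 : ρ ≠ 0 := (hr.trans_lt hlt).ne'
  simpa [h0, meanSq] using h

theorem MemH2.meanSq_comp_le {f : 𝔻 → ℂ} (hf : MemH2 f) {φ : 𝔻 → 𝔻}
    (hφ : IsHolo fun z => (φ z : ℂ)) {r : ℝ} (hr : r ∈ Set.Ico (0 : ℝ) 1) :
    meanSq (f ∘ φ) r ≤ 4 / (1 - ‖(φ 0 : ℂ)‖) * hardyNorm f ^ 2 := by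
  set ψ := ext0 fun z => (φ z : ℂ)
  set a := ‖(φ 0 : ℂ)‖
  have ha : a < 1 := (φ 0).norm_lt_one
  have hψ0 : ψ 0 = φ 0 := by
    have := ext0_coe (fun z => (φ z : ℂ)) 0
    simpa using this
  have hsub : closedBall (0 : ℂ) r ⊆ ball 0 1 := closedBall_subset_ball hr.2
  -- Compactness keeps the image of the closed r-disc inside a disc of radius ρ < 1. Taking ρ ≥ (1 +
  -- a)/2 as well gives ρ - a ≥ (1 - a)/2, whence the constant 4/(1 - a), independent of r.
  obtain ⟨ρ, hρ1, hρa, hmap⟩ : ∃ ρ < 1, (1 + a) / 2 ≤ ρ ∧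
      Set.MapsTo ψ (closedBall 0 r) (ball 0 ρ) := by
    obtain ⟨x, hx, hmax⟩ := (isCompact_closedBall (0 : ℂ) r).exists_isMaxOn
      ⟨0, by simpa using hr.1⟩ (hφ.continuousOn.mono hsub).norm
    have hx1 : ‖ψ x‖ < 1 := by simpa using mapsTo_ext0_coe φ (hsub hx)
    refine ⟨max ((1 + a) / 2) ((1 + ‖ψ x‖) / 2), max_lt (by linarith) (by linarith),
      le_max_left _ _, fun z hz => ?_⟩
    have : ‖ψ z‖ ≤ ‖ψ x‖ := hmax hz
    rw [mem_ball_zero_iff]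
    exact lt_of_le_of_lt this (lt_of_lt_of_le (by linarith) (le_max_right _ _))
  have h := circleAverage_norm_sq_comp_le hr.1 (hf.1.diffContOnCl hρ1) (hφ.diffContOnCl hr.2) hmap
  have h1 : meanSq (f ∘ φ) r = circleAverage (fun z => ‖ext0 f (ψ z)‖ ^ 2) 0 r := by
    refine circleAverage_congr_sphere fun z hz => ?_
    rw [abs_of_nonneg hr.1] at hz
    have hz' : ‖z‖ < 1 := by simpa using hsub (sphere_subset_closedBall hz)
    simp only [ext0_comp f φ hz', ψ]
  have ha0 : 0 ≤ a := norm_nonneg _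
  rw [h1]
  refine h.trans ?_
  rw [show ext0 (fun z => (φ z : ℂ)) 0 = φ 0 from hψ0]
  have h2 : circleAverage (fun z => ‖ext0 f z‖ ^ 2) 0 ρ ≤ hardyNorm f ^ 2 :=
    hf.meanSq_le_sq ⟨by linarith, hρ1⟩
  have h3 : (ρ + a) / (ρ - a) ≤ 4 / (1 - a) := by
    rw [div_le_div_iff₀ (by linarith) (by linarith)]
    nlinarith
  have h4 : 0 ≤ circleAverage (fun z => ‖ext0 f z‖ ^ 2) 0 ρ := meanSq_nonneg f ρ
  exact mul_le_mul h3 h2 h4 (div_nonneg (by norm_num) (by linarith))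

theorem MemH2.comp {f : 𝔻 → ℂ} (hf : MemH2 f) {φ : 𝔻 → 𝔻} (hφ : IsHolo fun z => (φ z : ℂ)) :
    MemH2 (f ∘ φ) :=
  ⟨hf.1.comp hφ, _, by rintro _ ⟨r, rfl⟩; exact hf.meanSq_comp_le hφ r.2⟩

theorem MemH2.hardyNorm_comp_le {f : 𝔻 → ℂ} (hf : MemH2 f) {φ : 𝔻 → 𝔻}
    (hφ : IsHolo fun z => (φ z : ℂ)) :
    hardyNorm (f ∘ φ) ≤ √(4 / (1 - ‖(φ 0 : ℂ)‖)) * hardyNorm f := by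
  have ha : ‖(φ 0 : ℂ)‖ < 1 := (φ 0).norm_lt_one
  refine hardyNorm_le_of_meanSq_le (mul_nonneg (sqrt_nonneg _) (hardyNorm_nonneg f)) fun r hr => ?_
  rw [mul_pow, Real.sq_sqrt (div_nonneg (by norm_num) (by linarith))]
  exact hf.meanSq_comp_le hφ hr

/-- Point evaluations are bounded on `H²`. -/
theorem MemH2.norm_apply_le {f : 𝔻 → ℂ} (hf : MemH2 f) (z : 𝔻) :
    ‖f z‖ ≤ √(4 / (1 - ‖(z : ℂ)‖)) * hardyNorm f := by
  have hz : ‖(z : ℂ)‖ < 1 := z.norm_lt_one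
  -- Composition with the constant map z turns the mean over the degenerate circle r = 0 into
  -- |f(z)|².
  have h := hf.meanSq_comp_le (φ := fun _ => z) (isHolo_const z) (r := 0) (by simp)
  have h1 : meanSq (f ∘ fun _ => z) 0 = ‖f z‖ ^ 2 := by
    simp [meanSq, ext0_of_lt]
  rw [h1] at h
  refine abs_le_of_sq_le_sq' ?_ (mul_nonneg (sqrt_nonneg _) (hardyNorm_nonneg f)) |>.2
  rwa [mul_pow, Real.sq_sqrt (div_nonneg (by norm_num) (by linarith))]

/-- Composition with a holomorphic self map of the disc, as a bounded operator on `H²`. -/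
def compCLM (φ : 𝔻 → 𝔻) (hφ : IsHolo fun z => (φ z : ℂ)) : H2 →L[ℂ] H2 :=
  LinearMap.mkContinuous
    { toFun := fun f => (⟨H2.toFun f ∘ φ, f.2.comp hφ⟩ : hardySubmodule)
      map_add' := fun _ _ => rfl
      map_smul' := fun _ _ => rfl }
    (√(4 / (1 - ‖(φ 0 : ℂ)‖))) fun f => f.2.hardyNorm_comp_le hφ

theorem compCLM_apply (φ : 𝔻 → 𝔻) (hφ : IsHolo fun z => (φ z : ℂ)) (f : H2) (w : 𝔻) :
    compCLM φ hφ f w = f (φ w) := rfl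

/-! ### Completeness of the Hardy space -/

theorem IsHolo.sub {f g : 𝔻 → ℂ} (hf : IsHolo f) (hg : IsHolo g) : IsHolo (f - g) := by
  rw [sub_eq_add_neg, ← neg_one_smul ℂ g]
  exact hf.add (hg.smul _)

theorem meanSq_mono_norm {f g : 𝔻 → ℂ} (hf : IsHolo f) (hg : IsHolo g) {r : ℝ}
    (hr : r ∈ Set.Ico (0 : ℝ) 1) (h : ∀ z : 𝔻, ‖(z : ℂ)‖ = r → ‖f z‖ ≤ ‖g z‖) :
    meanSq f r ≤ meanSq g r := by
  refine circleAverage_mono (hf.circleIntegrable hr) (hg.circleIntegrable hr) fun w hw => ?_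
  have hw' : ‖w‖ = r := by simpa [abs_of_nonneg hr.1] using hw
  have hw1 : ‖w‖ < 1 := hw'.trans_lt hr.2
  rw [ext0_of_lt hw1, ext0_of_lt hw1]
  have := h (UnitDisc.mk w hw1) (by simpa using hw')
  gcongr

theorem meanSq_const (c : ℂ) {r : ℝ} (hr : r ∈ Set.Ico (0 : ℝ) 1) :
    meanSq (fun _ => c) r = ‖c‖ ^ 2 := by
  refine circleAverage_const_on_circle fun w hw => ?_
  have hw' : ‖w‖ = r := by simpa [abs_of_nonneg hr.1] using hw
  rw [ext0_of_lt (hw'.trans_lt hr.2)]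

theorem meanSq_le_of_norm_le {f : 𝔻 → ℂ} (hf : IsHolo f) {r b : ℝ}
    (hr : r ∈ Set.Ico (0 : ℝ) 1) (hb : 0 ≤ b) (h : ∀ z : 𝔻, ‖(z : ℂ)‖ = r → ‖f z‖ ≤ b) :
    meanSq f r ≤ b ^ 2 := by
  have h1 := meanSq_mono_norm hf (isHolo_const (b : ℂ)) hr fun z hz => by
    simpa [abs_of_nonneg hb] using h z hz
  rw [meanSq_const _ hr] at h1
  simpa using h1

/-- A locally uniform limit of holomorphic functions on the disc is holomorphic. -/
theorem isHolo_of_tendsto {u : ℕ → 𝔻 → ℂ} {f : 𝔻 → ℂ} (hu : ∀ n, IsHolo (u n))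
    (h : ∀ r < 1, ∀ e > 0, ∀ᶠ n in atTop, ∀ z : 𝔻, ‖(z : ℂ)‖ ≤ r → ‖u n z - f z‖ < e) :
    IsHolo f := by
  refine TendstoLocallyUniformlyOn.differentiableOn (φ := atTop) (F := fun n => ext0 (u n))
    ?_ (Eventually.of_forall hu) isOpen_ball
  rw [Metric.tendstoLocallyUniformlyOn_iff]
  intro e he x hx
  have hx1 : ‖x‖ < 1 := by simpa using hx
  refine ⟨ball 0 ((1 + ‖x‖) / 2), mem_nhdsWithin_of_mem_nhds
    (isOpen_ball.mem_nhds (by rw [mem_ball_zero_iff]; linarith)), ?_⟩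
  filter_upwards [h ((1 + ‖x‖) / 2) (by linarith) e he] with n hn y hy
  have hy : ‖y‖ < (1 + ‖x‖) / 2 := by simpa using hy
  have hy1 : ‖y‖ < 1 := by linarith
  rw [dist_comm, dist_eq_norm, ext0_of_lt hy1, ext0_of_lt hy1]
  exact hn (UnitDisc.mk y hy1) (by simpa using hy.le)

theorem H2.norm_sub_apply_le (f g : H2) {r : ℝ} (hr : r < 1) {z : 𝔻} (hz : ‖(z : ℂ)‖ ≤ r) :
    ‖f z - g z‖ ≤ √(4 / (1 - r)) * ‖f - g‖ := by
  have h : ‖f z - g z‖ ≤ √(4 / (1 - ‖(z : ℂ)‖)) * ‖f - g‖ :=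
    MemH2.norm_apply_le (f - g).2 z
  refine h.trans ?_
  have : 0 < 1 - r := by linarith
  gcongr

/-- The element of `H²` given by a function satisfying `MemH2`. -/
def H2.mk (f : 𝔻 → ℂ) (hf : MemH2 f) : H2 := (⟨f, hf⟩ : hardySubmodule)

/-- Bounded point evaluations make a Cauchy sequence converge uniformly on smaller discs, so the
limit is holomorphic. Completeness is what makes the range of an isometry closed. -/
instance : CompleteSpace H2 := by
  refine Metric.complete_of_cauchySeq_tendsto fun u hu => ?_
  have hlip : ∀ {r : ℝ}, r < 1 → ∀ e > 0, ∃ N, ∀ m ≥ N, ∀ n ≥ N, ∀ z : 𝔻, ‖(z : ℂ)‖ ≤ r →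
      ‖u m z - u n z‖ < e := by
    intro r hr e he
    have hK : 0 < √(4 / (1 - r)) := Real.sqrt_pos.2 (div_pos (by norm_num) (by linarith))
    obtain ⟨N, hN⟩ := Metric.cauchySeq_iff.1 hu (e / √(4 / (1 - r))) (by positivity)
    refine ⟨N, fun m hm n hn z hz => ?_⟩
    have h := hN m hm n hn
    rw [dist_eq_norm, lt_div_iff₀ hK] at h
    have h1 := H2.norm_sub_apply_le (u m) (u n) hr hz
    linarith
  have hlim : ∀ z : 𝔻, ∃ y, Tendsto (fun n => u n z) atTop (𝓝 y) := fun z => by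
    refine cauchySeq_tendsto_of_complete (Metric.cauchySeq_iff.2 fun e he => ?_)
    obtain ⟨N, hN⟩ := hlip z.norm_lt_one e he
    exact ⟨N, fun m hm n hn => by
      rw [dist_eq_norm]; exact hN m hm n hn z le_rfl⟩
  choose f hf using hlim
  have hunif : ∀ r < 1, ∀ e > 0, ∀ᶠ n in atTop, ∀ z : 𝔻, ‖(z : ℂ)‖ ≤ r →
      ‖u n z - f z‖ < e := by
    intro r hr e he
    obtain ⟨N, hN⟩ := hlip hr (e / 2) (half_pos he)
    filter_upwards [eventually_ge_atTop N] with n hn z hz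
    have h : ‖u n z - f z‖ ≤ e / 2 := by
      refine le_of_tendsto ((tendsto_const_nhds.sub (hf z)).norm) ?_
      filter_upwards [eventually_ge_atTop N] with m hm using (hN n hn m hm z hz).le
    linarith
  have hholo : IsHolo f := isHolo_of_tendsto (fun n => (u n).2.1) hunif
  have hmean : ∀ e > 0, ∀ᶠ n in atTop, ∀ r ∈ Set.Ico (0 : ℝ) 1,
      meanSq (H2.toFun (u n) - f) r ≤ e ^ 2 := by
    intro e he
    obtain ⟨N, hN⟩ := Metric.cauchySeq_iff.1 hu (e / 2) (half_pos he)
    filter_upwards [eventually_ge_atTop N] with n hn r hr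
    -- The index m may depend on r: it only mediates between u n and f on the circle of radius r,
    -- and the final bound is uniform in r.
    obtain ⟨m, hm, hmN⟩ := ((hunif r hr.2 (e / 2) (half_pos he)).and
      (eventually_ge_atTop N)).exists
    have h1 : meanSq (H2.toFun (u n - u m)) r ≤ (e / 2) ^ 2 := by
      refine (MemH2.meanSq_le_sq (u n - u m).2 hr).trans ?_
      have h2 : ‖u n - u m‖ < e / 2 := by
        rw [← dist_eq_norm]; exact hN n hn m hmN
      exact pow_le_pow_left₀ (hardyNorm_nonneg _) h2.le 2
    have h3 : meanSq (H2.toFun (u m) - f) r ≤ (e / 2) ^ 2 :=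
      meanSq_le_of_norm_le ((u m).2.1.sub hholo) hr (half_pos he).le fun z hz =>
        (hm z hz.le).le
    have h4 := DiscHardy.meanSq_add_le (u n - u m).2.1 ((u m).2.1.sub hholo) hr (half_pos he)
      (half_pos he) h1 h3
    have h5 : H2.toFun (u n - u m) + (H2.toFun (u m) - f) = H2.toFun (u n) - f := by
      rw [map_sub]; abel
    have h6 : meanSq (H2.toFun (u n) - f) r ≤ (e / 2 + e / 2) ^ 2 := by
      rw [← h5]; exact h4
    rwa [add_halves] at h6
  have hmem : MemH2 f := by
    obtain ⟨n, hn⟩ := (hmean 1 one_pos).exists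
    have h1 : MemH2 (H2.toFun (u n) - f) := memH2_of_meanSq_le ((u n).2.1.sub hholo) hn
    have h2 : f = H2.toFun (u n) + (-1 : ℂ) • (H2.toFun (u n) - f) := by
      simp
    rw [h2]
    exact MemH2.add (u n).2 (h1.smul _)
  refine ⟨H2.mk f hmem, ?_⟩
  rw [Metric.tendsto_atTop']
  intro e he
  obtain ⟨N, hN⟩ := eventually_atTop.1 (hmean (e / 2) (half_pos he))
  refine ⟨N, fun n hn => ?_⟩
  rw [dist_eq_norm]
  have : hardyNorm (H2.toFun (u n) - f) ≤ e / 2 :=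
    hardyNorm_le_of_meanSq_le (half_pos he).le (hN n hn.le)
  exact this.trans_lt (half_lt_self he)

/-! ### Blaschke factors -/

theorem one_sub_conj_mul_ne_zero {a w : ℂ} (ha : ‖a‖ < 1) (hw : ‖w‖ ≤ 1) :
    1 - (starRingEnd ℂ) a * w ≠ 0 := fun h => by
  have h1 : (starRingEnd ℂ) a * w = 1 := (sub_eq_zero.1 h).symm
  have h2 : ‖a‖ * ‖w‖ = 1 := by
    rw [← RCLike.norm_conj a, ← norm_mul]; simp [h1]
  nlinarith [norm_nonneg a, norm_nonneg w]

theorem norm_sq_one_sub_conj_mul (a w : ℂ) :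
    ‖1 - (starRingEnd ℂ) a * w‖ ^ 2 = ‖a - w‖ ^ 2 + (1 - ‖a‖ ^ 2) * (1 - ‖w‖ ^ 2) := by
  simp only [← normSq_eq_norm_sq, normSq_apply]
  simp
  ring

theorem norm_blaschkeFactor (a w : 𝔻) :
    ‖blaschkeFactor a w‖ = ‖(a : ℂ) - w‖ / ‖1 - (starRingEnd ℂ) (a : ℂ) * w‖ := by
  unfold blaschkeFactor
  split_ifs with h
  · simp [h]
  · have : ‖(a : ℂ)‖ ≠ 0 := norm_ne_zero_iff.2 h
    simp [this]

theorem norm_blaschkeFactor_sq (a w : 𝔻) :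
    ‖blaschkeFactor a w‖ ^ 2 = 1 - (1 - ‖(a : ℂ)‖ ^ 2) * (1 - ‖(w : ℂ)‖ ^ 2) /
      ‖1 - (starRingEnd ℂ) (a : ℂ) * w‖ ^ 2 := by
  have h : ‖1 - (starRingEnd ℂ) (a : ℂ) * w‖ ≠ 0 :=
    norm_ne_zero_iff.2 (one_sub_conj_mul_ne_zero a.norm_lt_one w.norm_lt_one.le)
  rw [norm_blaschkeFactor, div_pow, eq_sub_iff_add_eq, ← add_div, ← norm_sq_one_sub_conj_mul,
    div_self (pow_ne_zero 2 h)]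

theorem norm_blaschkeFactor_le_one (a w : 𝔻) : ‖blaschkeFactor a w‖ ≤ 1 := by
  have h := norm_blaschkeFactor_sq a w
  have ha := a.sq_norm_lt_one
  have hw := w.sq_norm_lt_one
  have h1 : 0 ≤ (1 - ‖(a : ℂ)‖ ^ 2) * (1 - ‖(w : ℂ)‖ ^ 2) /
      ‖1 - (starRingEnd ℂ) (a : ℂ) * w‖ ^ 2 :=
    div_nonneg (mul_nonneg (by linarith) (by linarith)) (by positivity)
  exact (sq_le_one_iff₀ (norm_nonneg _)).1 (by linarith)

/-- For a ≠ 0, b_a(w) - 1 = -(1 - |a|)(a + |a|w) / (a(1 - āw)), with |a + |a|w| ≤ 2|a| and |1 - āw|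
≥ 1 - r. Uniformity in |w| ≤ r yields locally uniform control of the tails. -/
theorem norm_blaschkeFactor_sub_one_le (a w : 𝔻) {r : ℝ} (hr : r < 1) (hw : ‖(w : ℂ)‖ ≤ r) :
    ‖blaschkeFactor a w - 1‖ ≤ 2 / (1 - r) * (1 - ‖(a : ℂ)‖) := by
  have hw1 := w.norm_lt_one
  have ha1 := a.norm_lt_one
  have hr0 : 0 < 1 - r := by linarith
  unfold blaschkeFactor
  split_ifs with h
  · rw [h, norm_zero, sub_zero, mul_one]
    have h1 : ‖(w : ℂ) - 1‖ ≤ 2 := (norm_sub_le _ _).trans (by simp; linarith)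
    refine h1.trans ((le_div_iff₀ hr0).2 ?_)
    linarith [norm_nonneg (w : ℂ)]
  · have hd := one_sub_conj_mul_ne_zero ha1 hw1.le
    have ha0 : 0 < ‖(a : ℂ)‖ := norm_pos_iff.2 h
    have h1 : (‖(a : ℂ)‖ : ℂ) / a * ((a - w) / (1 - (starRingEnd ℂ) (a : ℂ) * w)) - 1
        = -((1 - ‖(a : ℂ)‖ : ℝ) : ℂ) * (a + ‖(a : ℂ)‖ * w) /
          (a * (1 - (starRingEnd ℂ) (a : ℂ) * w)) := by
      rw [div_mul_div_comm, div_sub_one (mul_ne_zero h hd)]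
      congr 1
      have h2 : (starRingEnd ℂ) (a : ℂ) * a = (‖(a : ℂ)‖ : ℂ) ^ 2 := Complex.conj_mul' _
      push_cast
      linear_combination (w : ℂ) * h2
    have h3 : ‖(a : ℂ) + ‖(a : ℂ)‖ * w‖ ≤ ‖(a : ℂ)‖ * 2 := by
      refine (norm_add_le _ _).trans ?_
      rw [norm_mul]
      simp only [norm_real, norm_norm]
      nlinarith
    have h4 : 1 - r ≤ ‖1 - (starRingEnd ℂ) (a : ℂ) * w‖ := by
      have h5 := norm_sub_norm_le (1 : ℂ) ((starRingEnd ℂ) (a : ℂ) * w)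
      rw [norm_one, norm_mul, RCLike.norm_conj] at h5
      nlinarith [norm_nonneg (w : ℂ)]
    rw [h1, norm_div, norm_mul, norm_neg, norm_mul, norm_real, Real.norm_of_nonneg (by linarith)]
    rw [div_le_iff₀ (mul_pos ha0 (by linarith))]
    calc (1 - ‖(a : ℂ)‖) * ‖(a : ℂ) + ‖(a : ℂ)‖ * w‖ ≤ (1 - ‖(a : ℂ)‖) * (‖(a : ℂ)‖ * 2) := by
          gcongr
      _ = 2 / (1 - r) * (1 - ‖(a : ℂ)‖) * (‖(a : ℂ)‖ * (1 - r)) := by field_simp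
      _ ≤ _ := by
        have : 0 ≤ 2 / (1 - r) * (1 - ‖(a : ℂ)‖) :=
          mul_nonneg (div_nonneg (by norm_num) hr0.le) (by linarith)
        gcongr

theorem isHolo_blaschkeFactor (a : 𝔻) : IsHolo (blaschkeFactor a) := by
  by_cases h : (a : ℂ) = 0
  · exact IsHolo.congr differentiableOn_id fun w => by simp [blaschkeFactor, h]
  · refine IsHolo.congr (F := fun w =>
      ((‖(a : ℂ)‖ : ℂ) / a) * ((a - w) / (1 - (starRingEnd ℂ) (a : ℂ) * w))) ?_ fun w => by
        simp [blaschkeFactor, h]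
    refine DifferentiableOn.const_mul (DifferentiableOn.div (by fun_prop) (by fun_prop) ?_) _
    exact fun w hw => one_sub_conj_mul_ne_zero a.norm_lt_one (mem_ball_zero_iff.1 hw).le

/-! ### Removing Blaschke factors from square means -/

theorem le_of_forall_sq_mul_le {x y : ℝ} (h : ∀ d ∈ Set.Ioo (0 : ℝ) 1, d ^ 2 * x ≤ y) :
    x ≤ y := by
  have h1 : Tendsto (fun d : ℝ => d ^ 2 * x) (𝓝[<] 1) (𝓝 (1 ^ 2 * x)) :=
    ((continuous_id.pow 2).mul continuous_const).continuousWithinAt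
  rw [one_pow, one_mul] at h1
  exact le_of_tendsto h1 (by
    filter_upwards [Ioo_mem_nhdsLT (zero_lt_one' ℝ)] with d hd using h d hd)

theorem sq_mul_meanSq_le {f g : 𝔻 → ℂ} (hf : IsHolo f) (hg : IsHolo g) {r d : ℝ}
    (hr : r ∈ Set.Ico (0 : ℝ) 1) (hd : 0 ≤ d) (h : ∀ z : 𝔻, ‖(z : ℂ)‖ = r → d ≤ ‖g z‖) :
    d ^ 2 * meanSq f r ≤ meanSq (g * f) r := by
  have h1 := meanSq_smul (d : ℂ) f r
  rw [norm_real, Real.norm_of_nonneg hd] at h1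
  rw [← h1]
  refine meanSq_mono_norm (hf.smul _) (hg.mul hf) hr fun z hz => ?_
  simp only [Pi.smul_apply, Pi.mul_apply, smul_eq_mul, norm_mul, norm_real,
    Real.norm_of_nonneg hd]
  gcongr
  exact h z hz

/-- Square means increase with the radius, and |b_a| tends to 1 uniformly at the boundary; so the
mean of f is compared with that of b_a f on a circle where |b_a| ≥ d, and then d → 1. -/
theorem meanSq_le_of_blaschkeFactor_mul {f : 𝔻 → ℂ} (hf : IsHolo f) (a : 𝔻) {M : ℝ}
    (h : ∀ r ∈ Set.Ico (0 : ℝ) 1, meanSq (blaschkeFactor a * f) r ≤ M) :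
    ∀ r ∈ Set.Ico (0 : ℝ) 1, meanSq f r ≤ M := by
  refine fun r hr => le_of_forall_sq_mul_le fun d hd => ?_
  have ha1 := a.norm_lt_one
  have ha0 := norm_nonneg (a : ℂ)
  -- Since 1 - |b_a|² ≤ (1 - s²)/(1 - |a|)² on the circle of radius s, the condition 1 - s² ≤ q
  -- forces |b_a| ≥ d there.
  set q := (1 - d ^ 2) * (1 - ‖(a : ℂ)‖) ^ 2 with hq
  have hd2 : d ^ 2 < 1 := by nlinarith [hd.1, hd.2]
  have hqpos : 0 < q := mul_pos (by linarith) (pow_pos (by linarith) 2)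
  set s := max r √(1 - q)
  have hs : s ∈ Set.Ico (0 : ℝ) 1 := by
    refine ⟨hr.1.trans (le_max_left _ _), max_lt hr.2 ?_⟩
    rw [Real.sqrt_lt' one_pos]; linarith
  have hsq : 1 - s ^ 2 ≤ q := by
    have : √(1 - q) ≤ s := le_max_right _ _
    have := (Real.sqrt_le_left hs.1).1 this
    linarith
  calc d ^ 2 * meanSq f r ≤ d ^ 2 * meanSq f s := by
        gcongr; exact hf.meanSq_mono hr.1 (le_max_left _ _) hs.2
    _ ≤ meanSq (blaschkeFactor a * f) s := by
        refine sq_mul_meanSq_le hf (isHolo_blaschkeFactor a) hs hd.1.le fun z hz => ?_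
        refine abs_le_of_sq_le_sq' ?_ (norm_nonneg _) |>.2
        rw [norm_blaschkeFactor_sq, hz]
        have h4 : 1 - ‖(a : ℂ)‖ ≤ ‖1 - (starRingEnd ℂ) (a : ℂ) * z‖ := by
          have h5 := norm_sub_norm_le (1 : ℂ) ((starRingEnd ℂ) (a : ℂ) * z)
          rw [norm_one, norm_mul, RCLike.norm_conj] at h5
          nlinarith [z.norm_lt_one, norm_nonneg (z : ℂ)]
        have h6 : (1 - ‖(a : ℂ)‖ ^ 2) * (1 - s ^ 2) /
            ‖1 - (starRingEnd ℂ) (a : ℂ) * z‖ ^ 2 ≤ 1 - d ^ 2 := by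
          rw [div_le_iff₀ (pow_pos (lt_of_lt_of_le (by linarith) h4) 2)]
          have h7 : 0 ≤ 1 - s ^ 2 := by nlinarith [hs.1, hs.2]
          calc (1 - ‖(a : ℂ)‖ ^ 2) * (1 - s ^ 2) ≤ 1 * (1 - s ^ 2) := by
                gcongr; nlinarith
            _ ≤ q := by linarith
            _ ≤ _ := by
              rw [hq]
              have h8 : 0 ≤ 1 - ‖(a : ℂ)‖ := by linarith
              have h9 : 0 ≤ 1 - d ^ 2 := by linarith
              gcongr
        linarith
    _ ≤ M := h s hs

theorem isHolo_prod_blaschkeFactor (a : ℕ → 𝔻) (n : ℕ) :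
    IsHolo (∏ m ∈ Finset.range n, blaschkeFactor (a m)) := by
  induction n with
  | zero => exact isHolo_const 1
  | succ n ih => rw [Finset.prod_range_succ]; exact ih.mul (isHolo_blaschkeFactor _)

theorem meanSq_le_of_prod_blaschkeFactor_mul (a : ℕ → 𝔻) (n : ℕ) {f : 𝔻 → ℂ} (hf : IsHolo f)
    {M : ℝ} (h : ∀ r ∈ Set.Ico (0 : ℝ) 1,
      meanSq ((∏ m ∈ Finset.range n, blaschkeFactor (a m)) * f) r ≤ M) :
    ∀ r ∈ Set.Ico (0 : ℝ) 1, meanSq f r ≤ M := by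
  induction n generalizing f with
  | zero => simpa using h
  | succ n ih =>
    rw [Finset.prod_range_succ] at h
    simp only [mul_assoc] at h
    exact meanSq_le_of_blaschkeFactor_mul hf (a n) (ih ((isHolo_blaschkeFactor _).mul hf) h)

/-! ### Blaschke products as isometric multipliers -/

variable {a : ℕ → 𝔻}

theorem summable_norm_blaschkeFactor_sub_one (ha : Summable fun m => 1 - ‖(a m : ℂ)‖) (w : 𝔻) :
    Summable fun m => ‖blaschkeFactor (a m) w - 1‖ :=
  (ha.mul_left (2 / (1 - ‖(w : ℂ)‖))).of_nonneg_of_le (fun _ => norm_nonneg _) fun m =>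
    norm_blaschkeFactor_sub_one_le (a m) w w.norm_lt_one le_rfl

/-- A Blaschke product with summable zeros converges unconditionally. -/
theorem multipliable_blaschkeFactor (ha : Summable fun m => 1 - ‖(a m : ℂ)‖) (w : 𝔻) :
    Multipliable fun m => blaschkeFactor (a m) w := by
  simpa using multipliable_one_add_of_summable (summable_norm_blaschkeFactor_sub_one ha w)

theorem tendsto_prod_blaschkeFactor (ha : Summable fun m => 1 - ‖(a m : ℂ)‖) (w : 𝔻) :
    Tendsto (fun n => ∏ m ∈ Finset.range n, blaschkeFactor (a m) w) atTop
      (𝓝 (blaschkeProduct a w)) :=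
  (multipliable_blaschkeFactor ha w).hasProd.tendsto_prod_nat

theorem norm_blaschkeProduct_le_one (ha : Summable fun m => 1 - ‖(a m : ℂ)‖) (w : 𝔻) :
    ‖blaschkeProduct a w‖ ≤ 1 := by
  refine le_of_tendsto (tendsto_prod_blaschkeFactor ha w).norm (Eventually.of_forall fun n => ?_)
  rw [norm_prod]
  exact Finset.prod_le_one (fun _ _ => norm_nonneg _) fun _ _ => norm_blaschkeFactor_le_one _ _

theorem blaschkeProduct_eq_prod_mul (ha : Summable fun m => 1 - ‖(a m : ℂ)‖) (n : ℕ) :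
    blaschkeProduct a = (∏ m ∈ Finset.range n, blaschkeFactor (a m)) *
      blaschkeProduct fun m => a (m + n) := by
  funext w
  have h : Summable fun m => 1 - ‖(a (m + n) : ℂ)‖ :=
    (summable_nat_add_iff (f := fun m => 1 - ‖(a m : ℂ)‖) n).2 ha
  rw [Pi.mul_apply, Finset.prod_apply]
  have h1 := Multipliable.prod_mul_tprod_nat_mul' (f := fun m => blaschkeFactor (a m) w) (k := n)
    (multipliable_blaschkeFactor h w)
  exact h1.symm

theorem norm_blaschkeProduct_sub_one_le (ha : Summable fun m => 1 - ‖(a m : ℂ)‖) {w : 𝔻} {r : ℝ}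
    (hr : r < 1) (hw : ‖(w : ℂ)‖ ≤ r) :
    ‖blaschkeProduct a w - 1‖ ≤ Real.exp (2 / (1 - r) * ∑' m, (1 - ‖(a m : ℂ)‖)) - 1 := by
  refine le_of_tendsto ((tendsto_prod_blaschkeFactor ha w).sub_const 1).norm
    (Eventually.of_forall fun n => ?_)
  have h := Finset.norm_prod_one_add_sub_one_le (Finset.range n)
    fun m => blaschkeFactor (a m) w - 1
  simp only [add_sub_cancel] at h
  refine h.trans ?_
  have h1 : ∑ m ∈ Finset.range n, ‖blaschkeFactor (a m) w - 1‖ ≤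
      2 / (1 - r) * ∑' m, (1 - ‖(a m : ℂ)‖) := by
    rw [← tsum_mul_left]
    refine (Finset.sum_le_sum fun m _ => norm_blaschkeFactor_sub_one_le (a m) w hr hw).trans ?_
    refine (ha.mul_left _).sum_le_tsum _ fun m _ => ?_
    have := (a m).norm_lt_one
    exact mul_nonneg (div_nonneg (by norm_num) (by linarith)) (by linarith)
  gcongr

theorem eventually_norm_blaschkeProduct_sub_one_lt (ha : Summable fun m => 1 - ‖(a m : ℂ)‖)
    {r : ℝ} (hr : r < 1) {e : ℝ} (he : 0 < e) :
    ∀ᶠ n in atTop, ∀ w : 𝔻, ‖(w : ℂ)‖ ≤ r → ‖blaschkeProduct (fun m => a (m + n)) w - 1‖ < e := by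
  have h1 := tendsto_sum_nat_add fun m => 1 - ‖(a m : ℂ)‖
  have h2 : Tendsto (fun n => Real.exp (2 / (1 - r) * ∑' m, (1 - ‖(a (m + n) : ℂ)‖)) - 1) atTop
      (𝓝 (Real.exp (2 / (1 - r) * 0) - 1)) :=
    ((Real.continuous_exp.tendsto _).comp (h1.const_mul _)).sub_const 1
  rw [mul_zero, Real.exp_zero, sub_self] at h2
  filter_upwards [h2.eventually (gt_mem_nhds he)] with n hn w hw
  exact (norm_blaschkeProduct_sub_one_le
    ((summable_nat_add_iff (f := fun m => 1 - ‖(a m : ℂ)‖) n).2 ha) hr hw).trans_lt hn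

theorem isHolo_blaschkeProduct (ha : Summable fun m => 1 - ‖(a m : ℂ)‖) :
    IsHolo (blaschkeProduct a) := by
  refine isHolo_of_tendsto (fun n => isHolo_prod_blaschkeFactor a n) fun r hr e he => ?_
  filter_upwards [eventually_norm_blaschkeProduct_sub_one_lt ha hr he] with n hn w hw
  rw [blaschkeProduct_eq_prod_mul ha n, Pi.mul_apply, ← mul_one_sub, norm_mul, norm_sub_rev 1]
  refine lt_of_le_of_lt (mul_le_of_le_one_left (norm_nonneg _) ?_) (hn w hw)
  rw [Finset.prod_apply, norm_prod]
  exact Finset.prod_le_one (fun _ _ => norm_nonneg _) fun _ _ => norm_blaschkeFactor_le_one _ _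

theorem meanSq_le_of_blaschkeProduct_mul (ha : Summable fun m => 1 - ‖(a m : ℂ)‖) {f : 𝔻 → ℂ}
    (hf : IsHolo f) {M : ℝ} (h : ∀ r ∈ Set.Ico (0 : ℝ) 1, meanSq (blaschkeProduct a * f) r ≤ M) :
    ∀ r ∈ Set.Ico (0 : ℝ) 1, meanSq f r ≤ M := by
  refine fun r hr => le_of_forall_sq_mul_le fun d hd => ?_
  -- A tail with modulus at least d on the circle of radius r; the n preceding factors are removed
  -- by the finite case.
  obtain ⟨n, hn⟩ := (eventually_norm_blaschkeProduct_sub_one_lt ha hr.2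
    (sub_pos.2 hd.2)).exists
  have hholo : IsHolo (blaschkeProduct fun m => a (m + n)) :=
    isHolo_blaschkeProduct ((summable_nat_add_iff (f := fun m => 1 - ‖(a m : ℂ)‖) n).2 ha)
  refine (sq_mul_meanSq_le hf hholo hr hd.1.le fun z hz => ?_).trans
    (meanSq_le_of_prod_blaschkeFactor_mul a n (hholo.mul hf) ?_ r hr)
  · have h1 := hn z hz.le
    have h2 := norm_sub_norm_le (1 : ℂ) (blaschkeProduct (fun m => a (m + n)) z)
    rw [norm_one, norm_sub_rev] at h2
    linarith
  · rwa [← mul_assoc, ← blaschkeProduct_eq_prod_mul ha n]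

theorem MemH2.mul_of_norm_le {θ f : 𝔻 → ℂ} (hf : MemH2 f) (hθ : IsHolo θ)
    (h : ∀ z, ‖θ z‖ ≤ 1) :
    ∀ r ∈ Set.Ico (0 : ℝ) 1, meanSq (θ * f) r ≤ hardyNorm f ^ 2 := fun r hr =>
  (meanSq_mono_norm (hθ.mul hf.1) hf.1 hr fun z _ => by
    rw [Pi.mul_apply, norm_mul]
    exact mul_le_of_le_one_left (norm_nonneg _) (h z)).trans (hf.meanSq_le_sq hr)

theorem MemH2.blaschkeProduct_mul (ha : Summable fun m => 1 - ‖(a m : ℂ)‖) {f : 𝔻 → ℂ}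
    (hf : MemH2 f) : MemH2 (blaschkeProduct a * f) :=
  memH2_of_meanSq_le ((isHolo_blaschkeProduct ha).mul hf.1)
    (hf.mul_of_norm_le (isHolo_blaschkeProduct ha) (norm_blaschkeProduct_le_one ha))

theorem hardyNorm_blaschkeProduct_mul (ha : Summable fun m => 1 - ‖(a m : ℂ)‖) {f : 𝔻 → ℂ}
    (hf : MemH2 f) : hardyNorm (blaschkeProduct a * f) = hardyNorm f := by
  refine le_antisymm (hardyNorm_le_of_meanSq_le (hardyNorm_nonneg f)
    (hf.mul_of_norm_le (isHolo_blaschkeProduct ha) (norm_blaschkeProduct_le_one ha))) ?_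
  exact hardyNorm_le_of_meanSq_le (hardyNorm_nonneg _) (meanSq_le_of_blaschkeProduct_mul ha hf.1
    fun r hr => (hf.blaschkeProduct_mul ha).meanSq_le_sq hr)

/-- Multiplication by a Blaschke product is an isometry of `H²`. -/
def mulBlaschke (ha : Summable fun m => 1 - ‖(a m : ℂ)‖) : H2 →ₗᵢ[ℂ] H2 where
  toFun f := H2.mk (blaschkeProduct a * H2.toFun f) (MemH2.blaschkeProduct_mul ha f.2)
  map_add' f g := Subtype.ext (mul_add (blaschkeProduct a) (H2.toFun f) (H2.toFun g))
  map_smul' c f := Subtype.ext (mul_smul_comm c (blaschkeProduct a) (H2.toFun f))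
  norm_map' f := hardyNorm_blaschkeProduct_mul ha f.2

theorem mulH2_blaschkeProduct_le (ha : Summable fun m => 1 - ‖(a m : ℂ)‖) :
    mulH2 (blaschkeProduct a) ≤ hardySubmodule := by
  rintro _ ⟨f, hf, rfl⟩
  exact MemH2.blaschkeProduct_mul ha hf

theorem isClosed_comap_mulH2_blaschkeProduct (ha : Summable fun m => 1 - ‖(a m : ℂ)‖) :
    IsClosed (((mulH2 (blaschkeProduct a)).comap H2.toFun : Submodule ℂ H2) : Set H2) := by
  have h : (((mulH2 (blaschkeProduct a)).comap H2.toFun : Submodule ℂ H2) : Set H2) =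
      Set.range (mulBlaschke ha) := by
    ext f
    constructor
    · rintro ⟨g, hg, hgf⟩
      exact ⟨H2.mk g hg, Subtype.ext hgf⟩
    · rintro ⟨g, rfl⟩
      exact ⟨H2.toFun g, g.2, rfl⟩
  rw [h]
  exact (mulBlaschke ha).isometry.isClosedEmbedding.isClosed_range

/-! ### Automorphisms of the disc -/

theorem norm_mobius_lt_one (a z : 𝔻) :
    ‖((a : ℂ) - z) / (1 - (starRingEnd ℂ) (a : ℂ) * z)‖ < 1 := by
  have hd := one_sub_conj_mul_ne_zero a.norm_lt_one z.norm_lt_one.le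
  rw [norm_div, div_lt_one (norm_pos_iff.2 hd)]
  refine lt_of_pow_lt_pow_left₀ 2 (norm_nonneg _) ?_
  rw [norm_sq_one_sub_conj_mul]
  have ha := a.sq_norm_lt_one
  have hz := z.sq_norm_lt_one
  nlinarith

/-- The involutive automorphism of the disc that exchanges `0` and `a`. -/
def mobius (a z : 𝔻) : 𝔻 := UnitDisc.mk _ (norm_mobius_lt_one a z)

theorem coe_mobius (a z : 𝔻) :
    (mobius a z : ℂ) = ((a : ℂ) - z) / (1 - (starRingEnd ℂ) (a : ℂ) * z) := rfl

theorem mobius_zero (a : 𝔻) : mobius a 0 = a := UnitDisc.coe_injective (by simp [coe_mobius])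

theorem mobius_self (a : 𝔻) : mobius a a = 0 := UnitDisc.coe_injective (by simp [coe_mobius])

theorem mobius_mobius (a z : 𝔻) : mobius a (mobius a z) = z := by
  refine UnitDisc.coe_injective ?_
  have hd := one_sub_conj_mul_ne_zero a.norm_lt_one z.norm_lt_one.le
  have hd' := one_sub_conj_mul_ne_zero a.norm_lt_one (mobius a z).norm_lt_one.le
  rw [coe_mobius, div_eq_iff hd']
  have hq : (mobius a z : ℂ) * (1 - (starRingEnd ℂ) (a : ℂ) * z) = a - z := by
    rw [coe_mobius, div_mul_cancel₀ _ hd]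
  linear_combination -hq

theorem isHolo_mobius (a : 𝔻) : IsHolo fun z => (mobius a z : ℂ) := by
  refine IsHolo.congr (F := fun z => ((a : ℂ) - z) / (1 - (starRingEnd ℂ) (a : ℂ) * z)) ?_
    fun z => coe_mobius a z
  exact DifferentiableOn.div (by fun_prop) (by fun_prop)
    fun w hw => one_sub_conj_mul_ne_zero a.norm_lt_one (mem_ball_zero_iff.1 hw).le

theorem isAutomorphism_mobius (a : 𝔻) : IsAutomorphism (mobius a) :=
  ⟨isHolo_mobius a, mobius a, isHolo_mobius a, mobius_mobius a, mobius_mobius a⟩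

theorem IsAutomorphism.comp {φ ψ : 𝔻 → 𝔻} (hφ : IsAutomorphism φ) (hψ : IsAutomorphism ψ) :
    IsAutomorphism (φ ∘ ψ) := by
  obtain ⟨hφ, φ', hφ', h1, h2⟩ := hφ
  obtain ⟨hψ, ψ', hψ', h3, h4⟩ := hψ
  exact ⟨IsHolo.comp hφ hψ, ψ' ∘ φ', IsHolo.comp hψ' hφ', h1.comp h3, h2.comp h4⟩

theorem norm_le_of_isHolo_of_map_zero {φ : 𝔻 → 𝔻} (hφ : IsHolo fun z => (φ z : ℂ)) (h0 : φ 0 = 0)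
    (z : 𝔻) : ‖(φ z : ℂ)‖ ≤ ‖(z : ℂ)‖ := by
  have h := Complex.norm_le_norm_of_mapsTo_ball hφ
    ((mapsTo_ext0_coe φ).mono_right ball_subset_closedBall)
    (by have := ext0_coe (fun z => (φ z : ℂ)) 0; simpa [h0] using this) z.norm_lt_one
  rwa [ext0_coe] at h

/-- An automorphism of the disc that fixes the origin is a rotation. -/
theorem IsAutomorphism.eq_rotation {φ : 𝔻 → 𝔻} (hφ : IsAutomorphism φ) (h0 : φ 0 = 0) :
    ∃ c : ℂ, ‖c‖ = 1 ∧ ∀ z : 𝔻, (φ z : ℂ) = c * z := by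
  obtain ⟨hφ, ψ, hψ, h1, -⟩ := hφ
  have hψ0 : ψ 0 = 0 := by rw [← h0, h1, h0]
  have hn : ∀ z : 𝔻, ‖(φ z : ℂ)‖ = ‖(z : ℂ)‖ := fun z => by
    refine le_antisymm (norm_le_of_isHolo_of_map_zero hφ h0 z) ?_
    have := norm_le_of_isHolo_of_map_zero hψ hψ0 (φ z)
    rwa [h1] at this
  set F := ext0 fun z => (φ z : ℂ)
  have hF0 : F 0 = 0 := by
    have := ext0_coe (fun z => (φ z : ℂ)) 0; simpa [h0] using this
  have hhalf : ‖(1 / 2 : ℂ)‖ < 1 := by norm_num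
  -- Equality in the Schwarz lemma at one nonzero point suffices; 1/2 is an arbitrary choice.
  obtain ⟨c, hc, heq⟩ := Complex.affine_of_mapsTo_ball_of_exists_norm_dslope_eq_div'
    (f := F) (c := 0) (R₁ := 1) (R₂ := 1) hφ
    (by rw [hF0]; exact (mapsTo_ext0_coe φ).mono_right ball_subset_closedBall)
    ⟨1 / 2, by simpa using hhalf, by
      have h2 : ‖F (1 / 2)‖ = ‖(1 / 2 : ℂ)‖ := by
        simp only [F]
        rw [ext0_of_lt hhalf, hn]; simp
      rw [dslope_of_ne _ (by norm_num), slope_def_field, hF0, sub_zero, sub_zero, norm_div, h2]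
      norm_num⟩
  refine ⟨c, by simpa using hc, fun z => ?_⟩
  have h3 := heq (x := (z : ℂ)) (by simpa using z.norm_lt_one)
  simp only [F, ext0_coe] at h3
  rw [h3, show ext0 (fun z => (φ z : ℂ)) 0 = 0 from hF0]
  simp [mul_comm]

theorem IsAutomorphism.eq_mobius {φ : 𝔻 → 𝔻} (hφ : IsAutomorphism φ) :
    ∃ (a : 𝔻) (c : ℂ), ‖c‖ = 1 ∧ ∀ z : 𝔻, (φ z : ℂ) = c * mobius a z := by
  obtain ⟨a, ha⟩ : ∃ a, φ a = 0 := by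
    obtain ⟨-, ψ, -, -, h⟩ := hφ
    exact ⟨ψ 0, h 0⟩
  obtain ⟨c, hc, h⟩ := (hφ.comp (isAutomorphism_mobius a)).eq_rotation (by simp [mobius_zero, ha])
  refine ⟨a, c, hc, fun z => ?_⟩
  rw [← h, Function.comp_apply, mobius_mobius]

theorem blaschkeFactor_eq_mul_mobius (a : 𝔻) :
    ∃ c : ℂ, ‖c‖ = 1 ∧ ∀ w, blaschkeFactor a w = c * mobius a w := by
  by_cases h : (a : ℂ) = 0
  · exact ⟨-1, by simp, fun w => by simp [blaschkeFactor, coe_mobius, h]⟩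
  · refine ⟨(‖(a : ℂ)‖ : ℂ) / a, ?_, fun w => by simp [blaschkeFactor, coe_mobius, h]⟩
    have : ‖(a : ℂ)‖ ≠ 0 := norm_ne_zero_iff.2 h
    simp [this]

/-- Blaschke factors are carried to each other by automorphisms, up to unimodular constants. -/
theorem IsAutomorphism.blaschkeFactor_map {φ : 𝔻 → 𝔻} (hφ : IsAutomorphism φ) (a : 𝔻) :
    ∃ c : ℂ, ‖c‖ = 1 ∧ ∀ w, blaschkeFactor (φ a) (φ w) = c * blaschkeFactor a w := by
  -- Conjugating by the involutions that move a and φ(a) to 0 leaves an automorphism fixing 0, hence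
  -- a rotation.
  obtain ⟨c, hc, h⟩ := (((isAutomorphism_mobius (φ a)).comp hφ).comp
    (isAutomorphism_mobius a)).eq_rotation (by simp [mobius_zero, mobius_self])
  obtain ⟨c₁, hc₁, h₁⟩ := blaschkeFactor_eq_mul_mobius a
  obtain ⟨c₂, hc₂, h₂⟩ := blaschkeFactor_eq_mul_mobius (φ a)
  have hne : c₁ ≠ 0 := by rw [← norm_ne_zero_iff, hc₁]; exact one_ne_zero
  refine ⟨c₂ * c / c₁, by simp [hc, hc₁, hc₂], fun w => ?_⟩
  have h3 := h (mobius a w)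
  simp only [Function.comp_apply, mobius_mobius] at h3
  rw [h₁, h₂, h3]
  field_simp

/-! ### Parabolic automorphisms and their orbits -/

theorem isBoundaryFixedPoint_iff {φ : 𝔻 → 𝔻} {a : 𝔻} {c : ℂ}
    (h : ∀ z : 𝔻, (φ z : ℂ) = c * mobius a z) {w : ℂ} :
    IsBoundaryFixedPoint φ w ↔
      ‖w‖ = 1 ∧ c * (a - w) = w * (1 - (starRingEnd ℂ) (a : ℂ) * w) := by
  refine and_congr_right fun hw => ?_
  have hd := one_sub_conj_mul_ne_zero a.norm_lt_one hw.le
  have hcont : Tendsto (fun r : ℝ =>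
      c * (((a : ℂ) - r * w) / (1 - (starRingEnd ℂ) (a : ℂ) * (r * w)))) (𝓝[<] 1)
      (𝓝 (c * (((a : ℂ) - (1 : ℝ) * w) / (1 - (starRingEnd ℂ) (a : ℂ) * ((1 : ℝ) * w))))) := by
    have : ContinuousAt (fun r : ℝ =>
        c * (((a : ℂ) - r * w) / (1 - (starRingEnd ℂ) (a : ℂ) * (r * w)))) 1 := by
      refine continuousAt_const.mul (ContinuousAt.div (by fun_prop) (by fun_prop) ?_)
      simpa using hd
    exact this.tendsto.mono_left nhdsWithin_le_nhds
  rw [ofReal_one, one_mul] at hcont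
  have hlim : Tendsto (fun r : ℝ => ext0 (fun z => (φ z : ℂ)) (r * w)) (𝓝[<] 1)
      (𝓝 (c * (((a : ℂ) - w) / (1 - (starRingEnd ℂ) (a : ℂ) * w)))) := by
    refine hcont.congr' ?_
    filter_upwards [Ioo_mem_nhdsLT (zero_lt_one' ℝ)] with r hr
    have hr1 : ‖(r : ℂ) * w‖ < 1 := by simpa [hw, abs_of_pos hr.1] using hr.2
    rw [ext0_of_lt hr1, h, coe_mobius]; simp
  have key : c * (((a : ℂ) - w) / (1 - (starRingEnd ℂ) (a : ℂ) * w)) = w ↔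
      c * (a - w) = w * (1 - (starRingEnd ℂ) (a : ℂ) * w) := by
    rw [← mul_div_assoc, div_eq_iff hd]
  rw [← key]
  exact ⟨fun h1 => tendsto_nhds_unique hlim h1, fun h1 => by rwa [h1] at hlim⟩

/-- In a half-plane coordinate, a parabolic automorphism is a translation. -/
theorem IsParabolicAutomorphism.exists_translation {φ : 𝔻 → 𝔻} (hφ : IsParabolicAutomorphism φ) :
    ∃ w β : ℂ, ‖w‖ = 1 ∧ β ≠ 0 ∧ β.re = 0 ∧ ∀ z : 𝔻, w / (w - φ z) = w / (w - z) + β := by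
  obtain ⟨hφ, w, hw, huniq⟩ := hφ
  obtain ⟨a, c, hc, h⟩ := hφ.eq_mobius
  have hiff := @isBoundaryFixedPoint_iff φ a c h
  obtain ⟨hw1, hfix⟩ := hiff.1 hw
  have huniq' : ∀ v : ℂ, ‖v‖ = 1 →
      c * (a - v) = v * (1 - (starRingEnd ℂ) (a : ℂ) * v) → v = w :=
    fun v hv hv' => huniq v (hiff.2 ⟨hv, hv'⟩)
  have hw0 : w ≠ 0 := by rw [← norm_ne_zero_iff, hw1]; exact one_ne_zero
  set b := (starRingEnd ℂ) (a : ℂ) with hb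
  -- For a = 0 the fixed point equation is odd, so -w would be a second solution.
  have ha0 : (a : ℂ) ≠ 0 := fun ha0 => by
    have hb0 : b = 0 := by simp [hb, ha0]
    have h1 := huniq' (-w) (by simpa using hw1) (by
      rw [ha0, hb0] at hfix ⊢
      linear_combination -hfix)
    exact hw0 (self_eq_neg.1 h1.symm)
  have hb0 : b ≠ 0 := by simpa [hb] using ha0
  have hbn : ‖b‖ = ‖(a : ℂ)‖ := RCLike.norm_conj _
  -- the two roots of the fixed point equation coincide
  have hdouble : c * a = b * w ^ 2 := by
    -- The fixed point equation is b v² - (1 + c) v + c a = 0; by Vieta its other root is c a/(b w),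
    -- again unimodular.
    have h1 := huniq' (c * a / (b * w)) (by
      rw [norm_div, norm_mul, norm_mul, hc, hbn, hw1, one_mul, mul_one,
        div_self (norm_ne_zero_iff.2 ha0)]) (by
      field_simp
      linear_combination c * hfix)
    rw [div_eq_iff (mul_ne_zero hb0 hw0)] at h1
    rw [h1]; ring
  have hrel : 2 * (a * b) * w = b * w ^ 2 + a := by
    refine mul_left_cancel₀ hw0 ?_
    linear_combination (w - a) * hdouble + a * hfix
  have hab : (a : ℂ) * b = ((‖(a : ℂ)‖ ^ 2 : ℝ) : ℂ) := by
    rw [hb, Complex.mul_conj']; push_cast; rfl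
  have hs : (1 - a * b : ℂ) ≠ 0 := by
    rw [hab]
    have := a.sq_norm_lt_one
    exact_mod_cast (by linarith : (1 : ℝ) - ‖(a : ℂ)‖ ^ 2 ≠ 0)
  have hwne : ∀ z : 𝔻, w - z ≠ 0 := fun z hz => by
    have := z.norm_lt_one
    rw [← sub_eq_zero.1 hz, hw1] at this
    exact lt_irrefl _ this
  -- The explicit formula gives w/(w - φ(z)) = (1 - bz)(w - a)/((1 - ab)(w - z)). Writing 1 - bz =
  -- (1 - bw) + b(w - z) splits this into w/(w - z), by `hrel`, and the constant β.
  refine ⟨w, b * (w - a) / (1 - a * b), hw1, ?_, ?_, fun z => ?_⟩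
  · exact div_ne_zero (mul_ne_zero hb0 (hwne a)) hs
  · have hconj : (starRingEnd ℂ) (b * (w - a) / (1 - a * b)) = -(b * (w - a) / (1 - a * b)) := by
      have hww : (starRingEnd ℂ) w * w = 1 := by
        rw [Complex.conj_mul', hw1]; simp
      have h1 : (starRingEnd ℂ) b = a := by simp [hb]
      have h2 : (starRingEnd ℂ) (a : ℂ) = b := rfl
      simp only [map_div₀, map_mul, map_sub, map_one, h1, h2]
      rw [mul_comm b (a : ℂ), ← neg_div]
      congr 1
      linear_combination -(starRingEnd ℂ) w * hrel + (2 * a * b - b * w) * hww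
    have := congrArg re hconj
    rw [conj_re, neg_re] at this
    linarith
  · have hd := one_sub_conj_mul_ne_zero a.norm_lt_one z.norm_lt_one.le
    have hz := hwne z
    have hz' := hwne (φ z)
    have hq : (mobius a z : ℂ) * (1 - b * z) = a - z := by
      rw [coe_mobius, div_mul_cancel₀ _ hd]
    rw [h] at hz' ⊢
    have e1 : (w - c * mobius a z) * ((1 - b * z) * (w - a)) = w * (1 - a * b) * (w - z) := by
      linear_combination -c * (w - a) * hq + (a - z) * hfix
    have e2 : (w - a) * (1 - b * w) = w * (1 - a * b) := by linear_combination hrel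
    rw [div_add_div _ _ hz hs, div_eq_div_iff hz' (mul_ne_zero hz hs)]
    linear_combination -e1 + (w - c * mobius a z) * e2

/-- The Poisson kernel is the real part of (w + z)/(w - z) = 2W - 1, where W = w/(w - z). -/
theorem sq_norm_mul_one_sub_sq_norm {w : ℂ} (hw : ‖w‖ = 1) (z : 𝔻) :
    ‖w / (w - z)‖ ^ 2 * (1 - ‖(z : ℂ)‖ ^ 2) = 2 * (w / (w - z)).re - 1 := by
  have hne : w - z ≠ 0 := fun hz => by
    have := z.norm_lt_one
    rw [← sub_eq_zero.1 hz, hw] at this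
    exact lt_irrefl _ this
  have h := congrFun (poissonKernel_eq_re_herglotzRieszKernel (c := 0) (w := (z : ℂ))) w
  simp only [poissonKernel_def, sub_zero, Function.comp_apply, herglotzRieszKernel_def] at h
  have h1 : (w + z) / (w - z) = 2 * (w / (w - z)) - 1 := by
    field_simp; ring
  rw [h1, hw] at h
  have h2 : (2 * (w / (w - z)) - 1).re = 2 * (w / (w - z)).re - 1 := by simp
  rw [← h2, ← h, norm_div, hw]
  ring

theorem summable_inv_sq_norm_add_mul (u : ℂ) {β : ℂ} (hβ : β ≠ 0) :
    Summable fun m : ℕ => (‖u + m * β‖ ^ 2)⁻¹ := by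
  have hβ' : 0 < ‖β‖ := norm_pos_iff.2 hβ
  obtain ⟨N, hN⟩ := exists_nat_gt (2 * ‖u‖ / ‖β‖)
  have hs : Summable fun m : ℕ => 4 / ‖β‖ ^ 2 * ((m : ℝ) ^ 2)⁻¹ :=
    (Real.summable_nat_pow_inv.2 one_lt_two).mul_left _
  refine hs.of_norm_bounded_eventually_nat ?_
  filter_upwards [eventually_ge_atTop (max N 1)] with m hm
  have hm1 : (1 : ℝ) ≤ m := by exact_mod_cast (le_max_right N 1).trans hm
  have hmN : (N : ℝ) ≤ m := by exact_mod_cast (le_max_left N 1).trans hm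
  rw [div_lt_iff₀ hβ'] at hN
  have h1 : m * ‖β‖ / 2 ≤ ‖u + m * β‖ := by
    have h2 := norm_sub_norm_le (m * β) (-u)
    rw [norm_mul, Complex.norm_natCast, norm_neg, sub_neg_eq_add, add_comm _ u] at h2
    nlinarith
  rw [Real.norm_of_nonneg (by positivity)]
  calc (‖u + m * β‖ ^ 2)⁻¹ ≤ ((m * ‖β‖ / 2) ^ 2)⁻¹ := by gcongr
    _ = _ := by field_simp; norm_num

/-- Orbits of parabolic automorphisms are Blaschke sequences. -/
theorem IsParabolicAutomorphism.summable_orbit {φ : 𝔻 → 𝔻} (hφ : IsParabolicAutomorphism φ)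
    (z : 𝔻) : Summable fun m : ℕ => 1 - ‖(φ^[m] z : ℂ)‖ := by
  obtain ⟨w, β, hw, hβ, hβre, h⟩ := hφ.exists_translation
  have horb : ∀ m : ℕ, w / (w - φ^[m] z) = w / (w - z) + m * β := fun m => by
    induction m with
    | zero => simp
    | succ m ih => rw [Function.iterate_succ_apply', h, ih]; push_cast; ring
  have hs := (summable_inv_sq_norm_add_mul (w / (w - z)) hβ).mul_left (2 * (w / (w - z)).re - 1)
  refine hs.of_nonneg_of_le (fun m => by linarith [(φ^[m] z).norm_lt_one]) fun m => ?_
  have h1 := sq_norm_mul_one_sub_sq_norm hw (φ^[m] z)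
  have hlt := (φ^[m] z).norm_lt_one
  have h2 : (w / (w - φ^[m] z)).re = (w / (w - z)).re := by
    rw [horb, add_re, mul_re, hβre]; simp
  have h3 : w / (w - φ^[m] z) ≠ 0 := by
    have hw0 : w ≠ 0 := by rw [← norm_ne_zero_iff, hw]; exact one_ne_zero
    refine div_ne_zero hw0 fun hz => ?_
    rw [← sub_eq_zero.1 hz, hw] at hlt
    exact lt_irrefl _ hlt
  rw [← horb, ← h2, ← h1, mul_assoc, mul_comm, mul_assoc,
    inv_mul_cancel₀ (pow_ne_zero 2 (norm_ne_zero_iff.2 h3)), mul_one]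
  nlinarith [norm_nonneg (φ^[m] z : ℂ)]

/-! ### Invariance under composition -/

/-- The Blaschke product of an orbit divides its composition with the automorphism. -/
theorem IsAutomorphism.blaschkeProduct_orbit_comp {φ : 𝔻 → 𝔻} (hφ : IsAutomorphism φ) {z : 𝔻}
    (ha : Summable fun m : ℕ => 1 - ‖(φ^[m] z : ℂ)‖) :
    ∃ c : ℂ, ∀ w, blaschkeProduct (fun m => φ^[m] z) (φ w) =
      blaschkeProduct (fun m => φ^[m] z) w * (c * blaschkeFactor z (φ w)) := by
  choose c hc h using fun m => hφ.blaschkeFactor_map (φ^[m] z)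
  -- Compactness of the circle gives a limit of the unimodular constants along one subsequence,
  -- chosen before w, so C serves every w.
  obtain ⟨C, -, ns, hns, hC⟩ := (isCompact_sphere (0 : ℂ) 1).tendsto_subseq
    (x := fun n => ∏ m ∈ Finset.range n, c m) fun n => by simp [norm_prod, hc]
  refine ⟨C, fun w => ?_⟩
  -- One more factor is taken at φ(w) than at w: its factor m = 0 is the extra b_z(φ(w)).
  have h1 := (tendsto_prod_blaschkeFactor ha (φ w)).comp
    ((tendsto_add_atTop_nat 1).comp hns.tendsto_atTop)
  have h2 := ((tendsto_prod_blaschkeFactor ha w).comp hns.tendsto_atTop).mul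
    (hC.mul_const (blaschkeFactor z (φ w)))
  refine tendsto_nhds_unique h1 (h2.congr fun n => ?_)
  simp only [Function.comp_apply, Finset.prod_range_succ', Function.iterate_succ_apply', h,
    Finset.prod_mul_distrib, Function.iterate_zero_apply]
  ring

end DiscHardy

end

theorem theorem4p1 (φ : 𝔻 → 𝔻) (hφ : DiscHardy.IsParabolicAutomorphism φ) :
    -- every orbit is Blaschke summable
    (∀ z : 𝔻, Summable fun m : ℕ => 1 - ‖(φ^[m] z : ℂ)‖) ∧
    -- composition with `φ` is a bounded operator `C` on `H²`, and for each `z` the Blaschke product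
    -- of the orbit of `z` converges and `B_z H²` is a closed `C`-invariant subspace of `H²`
    ∃ C : DiscHardy.H2 →L[ℂ] DiscHardy.H2,
      (∀ (f : DiscHardy.H2) (w : 𝔻), (C f) w = f (φ w)) ∧
      ∀ z : 𝔻,
        (∀ w : 𝔻, Multipliable fun m : ℕ => DiscHardy.blaschkeFactor (φ^[m] z) w) ∧
        DiscHardy.mulH2 (DiscHardy.blaschkeProduct fun m => φ^[m] z) ≤
          DiscHardy.hardySubmodule ∧
        (DiscHardy.mulH2 (DiscHardy.blaschkeProduct fun m => φ^[m] z)).comap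
          DiscHardy.H2.toFun ∈ DiscHardy.Lat C := by
  refine ⟨hφ.summable_orbit, DiscHardy.compCLM φ hφ.1.1, DiscHardy.compCLM_apply φ hφ.1.1,
    fun z => ?_⟩
  have ha := hφ.summable_orbit z
  refine ⟨DiscHardy.multipliable_blaschkeFactor ha, DiscHardy.mulH2_blaschkeProduct_le ha,
    DiscHardy.isClosed_comap_mulH2_blaschkeProduct ha, ?_⟩
  rintro f ⟨g, hg, hgf⟩
  obtain ⟨c, hc⟩ := hφ.1.blaschkeProduct_orbit_comp ha
  have hbg : DiscHardy.MemH2 (DiscHardy.blaschkeFactor z * g) :=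
    DiscHardy.memH2_of_meanSq_le ((DiscHardy.isHolo_blaschkeFactor z).mul hg.1)
      (hg.mul_of_norm_le (DiscHardy.isHolo_blaschkeFactor z)
        (DiscHardy.norm_blaschkeFactor_le_one z))
  refine ⟨c • ((DiscHardy.blaschkeFactor z * g) ∘ φ), (hbg.comp hφ.1.1).smul c, funext fun w => ?_⟩
  rw [DiscHardy.compCLM_apply, ← hgf]
  simp only [LinearMap.mulLeft_apply, Pi.mul_apply, Pi.smul_apply, Function.comp_apply,
    smul_eq_mul, hc]
  ring
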